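/- Let $\mathbb T=\mathbb R/\mathbb Z$, let $\|\cdot\|$ be the norm of the real space $L^2(\mathbb T)$, and define the real Hilbert spaces $$\mathcal H_0=\Big\{f\in L^2(\mathbb T):\int_0^1 f\,dx=0\Big\},\qquad \mathcal H_1=\Big\{q\in \mathcal H_0: q'\in L^2(\mathbb T)\Big\},$$ where $q'$ is the weak derivative on $\mathbb T$, with the norms $\|f\|_{\mathcal H_0}=\|f\|$ and $\|q\|_{\mathcal H_1}=\|q'\|$. A bijection between real Hilbert spaces is a real analytic isomorphism if both it and its inverse are real analytic. Let $m\ge 1$ be an integer. For $q\in\mathcal H_1$ put $v=2q$ and $$\mathcal E=-v'-\frac{v^2}{m},\qquad \mathcal E_0=\int_0^1\mathcal E\,dx,\qquad \mathcal E_1=-v'-\frac{v^2}{m}+\frac1m\int_0^1v^2\,dx .$$ ($\mathcal E$ is the eigenvalue in the direction $dx$ of the Ricci tensor of the warped product metric $dx^2+r(x)^2g_Y$, where $\dim Y=m$ and $r(x)=r_0\exp\big(\tfrac2m\int_0^xq\,dt\big)$.) **Corollary.** For every $q\in\mathcal H_1$ we have $\mathcal E_0=-\frac1m\|v\|^2$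 and $\mathcal E=\mathcal E_0+\mathcal E_1$. The mapping $q\mapsto\mathcal E_1$ is a real analytic isomorphism between $\mathcal H_1$ and $\mathcal H_0$, and for all $q\in\mathcal H_1$ $$\|v'\|^2\le\|\mathcal E_1\|^2\le\|v'\|^2+\frac{\|v\|^2\|v'\|^2}{m^2}-\frac{\|v\|^4}{m^2}.$$ Moreover, $\mathcal E_0$ is uniquely determined by $\mathcal E_1$: it is a function of $\mathcal E_1$, and for every $F\in\mathcal H_0$ there is exactly one pair $(q,e)\in\mathcal H_1\times\mathbb R$ with $-v'-\frac{v^2}{m}=e+F$ almost everywhere, where $v=2q$. In particular, if $m=1$, then for every $r_0>0$ and every $G_1\in\mathcal H_0$ there is exactly one pair $(r,G_0)$, consisting of a profile $r(x)=r_0\exp\big(2\int_0^xq\,dt\big)$ with $q\in\mathcal H_1$ and a constant $G_0\in\mathbb R$, such that the Gaussian curvature of the metric $dx^2+r(x)^2dy^2$ equals $G_0+G_1(x)$ for almost every $x$ and all $y$. -/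

import Mathlib

open MeasureTheory

noncomputable section

namespace PerturbedTorus

/-- Real `L²(𝕋)`, where `𝕋 = ℝ/ℤ` carries Lebesgue (Haar) measure of total mass `1`. -/
abbrev L2T : Type := Lp ℝ 2 (volume : Measure UnitAddCircle)

/-- The function on `ℝ` (1-periodic) obtained by lifting an element of `L²(𝕋)`. -/
def lift (f : L2T) (x : ℝ) : ℝ := f (x : UnitAddCircle)

/-- `g ∈ L²(𝕋)` is the weak derivative of `f ∈ L²(𝕋)`: for all smooth 1-periodic `φ`,
`∫₀¹ f φ' = - ∫₀¹ g φ`. -/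
def HasWeakDeriv (f g : L2T) : Prop :=
  ∀ φ : ℝ → ℝ, ContDiff ℝ (⊤ : ℕ∞) φ → Function.Periodic φ 1 →
    ∫ x in (0 : ℝ)..1, lift f x * deriv φ x = - ∫ x in (0 : ℝ)..1, lift g x * φ x

theorem memLp_lift (f : L2T) : MemLp (lift f) 2 (volume.restrict (Set.Ioc (0 : ℝ) 1)) := by
  have h := (Lp.memLp f).comp_measurePreserving (UnitAddCircle.measurePreserving_mk 0)
  rw [zero_add] at h
  exact h

theorem intervalIntegrable_lift (f : L2T) : IntervalIntegrable (lift f) volume 0 1 := by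
  rw [intervalIntegrable_iff_integrableOn_Ioc_of_le zero_le_one]
  exact (memLp_lift f).integrable (by norm_num)

theorem intervalIntegrable_lift_mul (f : L2T) {φ : ℝ → ℝ} (hφ : Continuous φ) :
    IntervalIntegrable (fun x => lift f x * φ x) volume 0 1 :=
  (intervalIntegrable_lift f).mul_continuousOn hφ.continuousOn

theorem integral_lift (f : L2T) : ∫ x in (0 : ℝ)..1, lift f x = ∫ x, f x := by
  have h := UnitAddCircle.intervalIntegral_preimage 0 (f : UnitAddCircle → ℝ)
  rw [zero_add] at h
  exact h

theorem ae_lift {P : ℝ → UnitAddCircle → Prop} {Q : UnitAddCircle → Prop}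
    (h : ∀ᵐ x, Q x) (hQ : ∀ x : ℝ, Q x → P x x) :
    ∀ᵐ x ∂(volume.restrict (Set.Ioc (0 : ℝ) 1)), P x x := by
  have h1 := (UnitAddCircle.measurePreserving_mk 0).quasiMeasurePreserving.ae h
  rw [zero_add] at h1
  filter_upwards [h1] with x hx using hQ x hx

theorem integral_lift_add (f g : L2T) {φ : ℝ → ℝ} (hφ : Continuous φ) :
    ∫ x in (0 : ℝ)..1, lift (f + g) x * φ x =
      (∫ x in (0 : ℝ)..1, lift f x * φ x) + ∫ x in (0 : ℝ)..1, lift g x * φ x := by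
  rw [← intervalIntegral.integral_add (intervalIntegrable_lift_mul f hφ)
    (intervalIntegrable_lift_mul g hφ), intervalIntegral.integral_of_le zero_le_one,
    intervalIntegral.integral_of_le zero_le_one]
  refine integral_congr_ae (ae_lift (P := fun x _ => lift (f + g) x * φ x
    = lift f x * φ x + lift g x * φ x) (Lp.coeFn_add f g) ?_)
  intro x hx
  simp only [lift, hx, Pi.add_apply]
  ring

theorem integral_lift_smul (c : ℝ) (f : L2T) (φ : ℝ → ℝ) :
    ∫ x in (0 : ℝ)..1, lift (c • f) x * φ x = c * ∫ x in (0 : ℝ)..1, lift f x * φ x := by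
  rw [← intervalIntegral.integral_const_mul, intervalIntegral.integral_of_le zero_le_one,
    intervalIntegral.integral_of_le zero_le_one]
  refine integral_congr_ae (ae_lift (P := fun x _ => lift (c • f) x * φ x
    = c * (lift f x * φ x)) (Lp.coeFn_smul c f) ?_)
  intro x hx
  simp only [lift, hx, Pi.smul_apply, smul_eq_mul]
  ring

theorem integral_lift_zero (φ : ℝ → ℝ) :
    ∫ x in (0 : ℝ)..1, lift (0 : L2T) x * φ x = 0 := by
  have h := integral_lift_smul 0 0 φ
  simpa using h

theorem HasWeakDeriv.zero : HasWeakDeriv 0 0 := by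
  intro φ _ _
  rw [integral_lift_zero, integral_lift_zero, neg_zero]

theorem HasWeakDeriv.add {f g f' g' : L2T} (h : HasWeakDeriv f g) (h' : HasWeakDeriv f' g') :
    HasWeakDeriv (f + f') (g + g') := by
  intro φ hφ hp
  rw [integral_lift_add _ _ (hφ.continuous_deriv (by simp)), integral_lift_add _ _ hφ.continuous,
    h φ hφ hp, h' φ hφ hp]
  ring

theorem HasWeakDeriv.smul {f g : L2T} (c : ℝ) (h : HasWeakDeriv f g) :
    HasWeakDeriv (c • f) (c • g) := by
  intro φ hφ hp
  rw [integral_lift_smul, integral_lift_smul, h φ hφ hp]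
  ring

theorem integral_eq_inner_one (f : L2T) :
    ∫ x, f x = inner ℝ (Lp.const 2 (volume : Measure UnitAddCircle) (1 : ℝ)) f := by
  rw [L2.inner_def]
  refine integral_congr_ae ?_
  filter_upwards [Lp.coeFn_const (p := 2) (μ := (volume : Measure UnitAddCircle)) (1 : ℝ)]
    with x hx
  rw [hx]
  simp

/-- An element of `L²(𝕋)` with zero mean which is orthogonal to the derivatives of all smooth
periodic functions is zero. -/
theorem eq_zero_of_integral_deriv (f : L2T) (h0 : ∫ x, f x = 0)
    (h : ∀ φ : ℝ → ℝ, ContDiff ℝ (⊤ : ℕ∞) φ → Function.Periodic φ 1 →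
      ∫ x in (0 : ℝ)..1, lift f x * deriv φ x = 0) : f = 0 := by
  have hC : MemLp (fun x => ((f x : ℝ) : ℂ)) 2 AddCircle.haarAddCircle :=
    memLp_haarAddCircle_iff.mpr (Lp.memLp f).ofReal
  have hcoef : ∀ n : ℤ, fourierCoeff (fun x => ((f x : ℝ) : ℂ)) n = 0 := by
    intro n
    rw [fourierCoeff_eq_intervalIntegral _ n 0, zero_add]
    have hcos : ∫ x in (0 : ℝ)..1, lift f x * Real.cos (2 * Real.pi * n * x) = 0 := by
      rcases eq_or_ne n 0 with rfl | hn
      · simpa [integral_lift] using h0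
      have hn' : (2 * Real.pi * n : ℝ) ≠ 0 := by
        have : (n : ℝ) ≠ 0 := by exact_mod_cast hn
        positivity
      have h1 := h (fun x => (2 * Real.pi * n)⁻¹ * Real.sin (2 * Real.pi * n * x))
        (by fun_prop) (by
          intro x
          have : 2 * Real.pi * n * (x + 1) = 2 * Real.pi * n * x + n * (2 * Real.pi) := by ring
          simp only [this, Real.sin_add_int_mul_two_pi])
      refine Eq.trans ?_ h1
      refine intervalIntegral.integral_congr fun x _ => ?_
      have hd : HasDerivAt (fun x : ℝ => (2 * Real.pi * n)⁻¹ * Real.sin (2 * Real.pi * n * x))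
          ((2 * Real.pi * n)⁻¹ * (Real.cos (2 * Real.pi * n * x) * (2 * Real.pi * n * 1))) x :=
        (((hasDerivAt_id x).const_mul (2 * Real.pi * n)).sin).const_mul _
      simp only [hd.deriv]
      field_simp
    have hsin : ∫ x in (0 : ℝ)..1, lift f x * Real.sin (2 * Real.pi * n * x) = 0 := by
      rcases eq_or_ne n 0 with rfl | hn
      · simp
      have hn' : (2 * Real.pi * n : ℝ) ≠ 0 := by
        have : (n : ℝ) ≠ 0 := by exact_mod_cast hn
        positivity
      have h1 := h (fun x => -(2 * Real.pi * n)⁻¹ * Real.cos (2 * Real.pi * n * x))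
        (by fun_prop) (by
          intro x
          have : 2 * Real.pi * n * (x + 1) = 2 * Real.pi * n * x + n * (2 * Real.pi) := by ring
          simp only [this, Real.cos_add_int_mul_two_pi])
      refine Eq.trans ?_ h1
      refine intervalIntegral.integral_congr fun x _ => ?_
      have hd : HasDerivAt (fun x : ℝ => -(2 * Real.pi * n)⁻¹ * Real.cos (2 * Real.pi * n * x))
          (-(2 * Real.pi * n)⁻¹ * (-Real.sin (2 * Real.pi * n * x) * (2 * Real.pi * n * 1))) x :=
        (((hasDerivAt_id x).const_mul (2 * Real.pi * n)).cos).const_mul _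
      simp only [hd.deriv]
      field_simp
    have hint : ∀ x : ℝ, (fourier (-n) (x : UnitAddCircle)) • ((f (x : UnitAddCircle) : ℝ) : ℂ)
        = ((lift f x * Real.cos (2 * Real.pi * n * x) : ℝ) : ℂ)
          - ((lift f x * Real.sin (2 * Real.pi * n * x) : ℝ) : ℂ) * Complex.I := by
      intro x
      rw [fourier_coe_apply]
      have : 2 * (Real.pi : ℂ) * Complex.I * ((-n : ℤ) : ℂ) * (x : ℂ) / ((1 : ℝ) : ℂ)
          = ((-(2 * Real.pi * n * x) : ℝ) : ℂ) * Complex.I := by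
        push_cast
        ring
      rw [this, Complex.exp_mul_I, ← Complex.ofReal_cos, ← Complex.ofReal_sin, Real.cos_neg,
        Real.sin_neg]
      simp only [lift, smul_eq_mul]
      push_cast
      ring
    have e : ∫ x in (0 : ℝ)..1,
        (fourier (-n) (x : UnitAddCircle)) • ((f (x : UnitAddCircle) : ℝ) : ℂ) = 0 := by
      simp_rw [hint]
      rw [intervalIntegral.integral_sub, intervalIntegral.integral_mul_const,
        intervalIntegral.integral_ofReal, intervalIntegral.integral_ofReal, hcos, hsin]
      · simp
      · have h1 : IntervalIntegrable (fun x => lift f x * Real.cos (2 * Real.pi * n * x))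
          volume 0 1 := intervalIntegrable_lift_mul f (by fun_prop)
        exact ⟨Integrable.ofReal h1.1, Integrable.ofReal h1.2⟩
      · have h1 : IntervalIntegrable (fun x => lift f x * Real.sin (2 * Real.pi * n * x))
          volume 0 1 := intervalIntegrable_lift_mul f (by fun_prop)
        exact IntervalIntegrable.mul_const ⟨Integrable.ofReal h1.1, Integrable.ofReal h1.2⟩ _
    rw [e, smul_zero]
  have hF : hC.toLp _ = 0 := by
    have hs := hasSum_fourier_series_L2 (hC.toLp _)
    have hz : ∀ i : ℤ, fourierCoeff (hC.toLp _) i = 0 := fun i => by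
      rw [fourierCoeff_congr_ae hC.coeFn_toLp, hcoef]
    simp only [hz, zero_smul] at hs
    exact hs.unique hasSum_zero
  have hae := (Lp.eq_zero_iff_ae_eq_zero).mp hF
  have hvol : (volume : Measure UnitAddCircle) = AddCircle.haarAddCircle := by
    rw [AddCircle.volume_eq_smul_haarAddCircle]
    simp
  rw [Lp.eq_zero_iff_ae_eq_zero]
  change ∀ᵐ x ∂(volume : Measure UnitAddCircle), f x = 0
  simp only [hvol]
  filter_upwards [hae, hC.coeFn_toLp] with x hx hx'
  rw [hx'] at hx
  simpa using hx

/-- Weak derivatives are unique. -/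
theorem HasWeakDeriv.unique {f g g' : L2T} (h : HasWeakDeriv f g) (h' : HasWeakDeriv f g') :
    g = g' := by
  have hd : HasWeakDeriv 0 (g + (-1 : ℝ) • g') := by
    have := h.add (h'.smul (-1))
    simpa using this
  have key : ∀ φ : ℝ → ℝ, ContDiff ℝ (⊤ : ℕ∞) φ → Function.Periodic φ 1 →
      ∫ x in (0 : ℝ)..1, lift (g + (-1 : ℝ) • g') x * φ x = 0 := by
    intro φ hφ hp
    have := hd φ hφ hp
    rw [integral_lift_zero] at this
    linarith
  have hz : g + (-1 : ℝ) • g' = 0 := by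
    refine eq_zero_of_integral_deriv _ ?_ fun φ hφ hp => ?_
    · have := key (fun _ => 1) contDiff_const (fun _ => rfl)
      simpa [integral_lift] using this
    · refine key (deriv φ) ?_ fun x => ?_
      · exact (contDiff_infty_iff_deriv.mp hφ).2
      · rw [← deriv_comp_add_const, show (fun y => φ (y + 1)) = φ from funext hp]
  rw [neg_one_smul, ← sub_eq_add_neg] at hz
  exact sub_eq_zero.mp hz

/-- `𝓗₀`: the real functions in `L²(𝕋)` with zero mean, with the `L²`-norm. -/
def H0 : Submodule ℝ L2T where
  carrier := {f | ∫ x, f x = 0}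
  zero_mem' := by
    simp only [Set.mem_ofPred_eq, integral_eq_inner_one, inner_zero_right]
  add_mem' := by
    intro f g hf hg
    simp only [Set.mem_ofPred_eq, integral_eq_inner_one] at hf hg ⊢
    rw [inner_add_right, hf, hg, add_zero]
  smul_mem' := by
    intro c f hf
    simp only [Set.mem_ofPred_eq, integral_eq_inner_one] at hf ⊢
    rw [inner_smul_right, hf, mul_zero]

theorem mem_H0 {f : L2T} : f ∈ H0 ↔ ∫ x, f x = 0 := Iff.rfl

instance : CompleteSpace H0 := by
  have : IsClosed (H0 : Set L2T) := by
    have : (H0 : Set L2T) = {f | inner ℝ (Lp.const 2 (volume : Measure UnitAddCircle) (1 : ℝ)) f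
        = (0 : ℝ)} := by
      ext f
      simp only [SetLike.mem_coe, mem_H0, Set.mem_ofPred_eq, integral_eq_inner_one]
    rw [this]
    exact isClosed_eq (by fun_prop) continuous_const
  exact this.completeSpace_coe

/-- The underlying vector space of `𝓗₁`: functions in `L²(𝕋)` with zero mean and a weak
derivative in `L²(𝕋)`. -/
def h1Submodule : Submodule ℝ L2T where
  carrier := {q | ∫ x, q x = 0 ∧ ∃ g : L2T, HasWeakDeriv q g}
  zero_mem' := ⟨H0.zero_mem, 0, HasWeakDeriv.zero⟩
  add_mem' := by
    rintro f g ⟨hf, f', hf'⟩ ⟨hg, g', hg'⟩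
    exact ⟨H0.add_mem hf hg, _, hf'.add hg'⟩
  smul_mem' := by
    rintro c f ⟨hf, f', hf'⟩
    exact ⟨H0.smul_mem c hf, _, hf'.smul c⟩

/-- The Sobolev space `𝓗₁`. It is a separate type because it carries the norm `‖q'‖` of `L²(𝕋)`,
not the restriction of the `L²`-norm. -/
def H1 : Type := h1Submodule

namespace H1

instance : AddCommGroup H1 := inferInstanceAs (AddCommGroup h1Submodule)

instance : Module ℝ H1 := inferInstanceAs (Module ℝ h1Submodule)

/-- The inclusion of `𝓗₁` into `L²(𝕋)`. -/
def toL2 : H1 →ₗ[ℝ] L2T := h1Submodule.subtype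

theorem toL2_injective : Function.Injective toL2 := h1Submodule.injective_subtype

theorem integral_toL2 (q : H1) : ∫ x, toL2 q x = 0 := q.2.1

theorem exists_hasWeakDeriv (q : H1) : ∃ g : L2T, HasWeakDeriv (toL2 q) g := q.2.2

/-- The weak derivative `q ↦ q'`, from `𝓗₁` to `L²(𝕋)`. -/
def weakDeriv : H1 →ₗ[ℝ] L2T where
  toFun q := (exists_hasWeakDeriv q).choose
  map_add' p q := by
    refine (exists_hasWeakDeriv (p + q)).choose_spec.unique ?_
    rw [map_add]
    exact (exists_hasWeakDeriv p).choose_spec.add (exists_hasWeakDeriv q).choose_spec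
  map_smul' c q := by
    refine (exists_hasWeakDeriv (c • q)).choose_spec.unique ?_
    rw [map_smul]
    exact (exists_hasWeakDeriv q).choose_spec.smul c

theorem hasWeakDeriv (q : H1) : HasWeakDeriv (toL2 q) (weakDeriv q) :=
  (exists_hasWeakDeriv q).choose_spec

theorem weakDeriv_injective : Function.Injective weakDeriv := by
  rw [injective_iff_map_eq_zero]
  intro q hq
  apply toL2_injective
  rw [map_zero]
  refine eq_zero_of_integral_deriv _ (integral_toL2 q) fun φ hφ hp => ?_
  rw [hasWeakDeriv q φ hφ hp, hq, integral_lift_zero, neg_zero]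

/-- The norm of `𝓗₁` is `‖q‖₁ = ‖q'‖`, the `L²`-norm of the derivative. -/
instance : NormedAddCommGroup H1 :=
  NormedAddCommGroup.induced H1 L2T weakDeriv weakDeriv_injective

theorem norm_def (q : H1) : ‖q‖ = ‖weakDeriv q‖ := rfl

/-- The inner product of `𝓗₁` is `(p, q) ↦ ∫ p' q'`. -/
instance : InnerProductSpace ℝ H1 where
  norm_smul_le c q := by
    rw [norm_def, norm_def, map_smul, norm_smul]
  inner p q := inner ℝ (weakDeriv p) (weakDeriv q)
  norm_sq_eq_re_inner q := norm_sq_eq_re_inner (weakDeriv q)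
  conj_inner_symm p q := inner_conj_symm (weakDeriv p) (weakDeriv q)
  add_left p q s := by
    rw [map_add, inner_add_left]
  smul_left p q c := by
    rw [map_smul, inner_smul_left]

theorem integral_weakDeriv (q : H1) : ∫ x, weakDeriv q x = 0 := by
  have h := hasWeakDeriv q (fun _ => 1) contDiff_const (fun _ => rfl)
  simpa [integral_lift] using h

/-- The derivative maps `𝓗₁` onto `𝓗₀`. -/
theorem range_weakDeriv : Set.range weakDeriv = (H0 : Set L2T) := by
  ext g
  constructor
  · rintro ⟨q, rfl⟩
    exact integral_weakDeriv q
  intro hg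
  have hg0 : ∫ x in (0 : ℝ)..1, lift g x = 0 := by rw [integral_lift]; exact hg
  set c : ℝ := ∫ x in (0 : ℝ)..1, ∫ t in (0 : ℝ)..x, lift g t with hc
  set G : ℝ → ℝ := fun x => (∫ t in (0 : ℝ)..x, lift g t) - c with hG
  have hac0 : AbsolutelyContinuousOnInterval (fun x => ∫ t in (0 : ℝ)..x, lift g t) 0 1 :=
    (intervalIntegrable_lift g).absolutelyContinuousOnInterval_intervalIntegral (by simp)
  have hac : AbsolutelyContinuousOnInterval G 0 1 := by
    refine hac0.fun_sub ?_
    exact ContDiffOn.absolutelyContinuousOnInterval contDiffOn_const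
  have hcont : ContinuousOn G (Set.Icc 0 1) := by
    simpa using hac.continuousOn
  have hGmem : MemLp G 2 (volume.restrict (Set.Ioc (0 : ℝ) (0 + 1))) := by
    rw [zero_add]
    obtain ⟨B, hB⟩ := isCompact_Icc.exists_bound_of_continuousOn hcont
    refine MemLp.of_bound ((hcont.mono Set.Ioc_subset_Icc_self).aestronglyMeasurable
      measurableSet_Ioc) B ?_
    filter_upwards [ae_restrict_mem measurableSet_Ioc] with x hx
    exact hB x (Set.Ioc_subset_Icc_self hx)
  have hmem : MemLp (AddCircle.liftIoc 1 0 G) 2 (volume : Measure UnitAddCircle) := by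
    simp only [AddCircle.liftIoc, Set.domRestrict_def, Function.comp_def]
    apply hGmem.comp_measurePreserving
    refine .comp (measurePreserving_subtype_coe measurableSet_Ioc) ?_
    exact AddCircle.measurePreserving_equivIoc 1
  have hae : ∀ᵐ x ∂(volume.restrict (Set.Ioc (0 : ℝ) 1)), lift (hmem.toLp _) x = G x := by
    have h1 := ae_lift (P := fun x y => lift (hmem.toLp _) x = AddCircle.liftIoc 1 0 G y)
      hmem.coeFn_toLp (fun x hx => hx)
    filter_upwards [h1, ae_restrict_mem measurableSet_Ioc] with x hx hx'
    rw [hx, AddCircle.liftIoc_coe_apply (by simpa using hx')]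
  have hint : ∀ ψ : ℝ → ℝ, ∫ x in (0 : ℝ)..1, lift (hmem.toLp _) x * ψ x
      = ∫ x in (0 : ℝ)..1, G x * ψ x := by
    intro ψ
    rw [intervalIntegral.integral_of_le zero_le_one, intervalIntegral.integral_of_le zero_le_one]
    refine integral_congr_ae ?_
    filter_upwards [hae] with x hx
    rw [hx]
  have hmean : ∫ x, hmem.toLp _ x = 0 := by
    have h1 := hint (fun _ => 1)
    simp only [mul_one, integral_lift] at h1
    rw [h1, hG, intervalIntegral.integral_sub hac0.continuousOn.intervalIntegrable (by simp)]
    simp [hc]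
  have hweak : HasWeakDeriv (hmem.toLp _) g := by
    intro φ hφ hp
    have hφac : AbsolutelyContinuousOnInterval φ 0 1 :=
      ContDiffOn.absolutelyContinuousOnInterval (hφ.of_le (by simp)).contDiffOn
    rw [hint, hac.integral_mul_deriv_eq_deriv_mul hφac]
    have e1 : ∫ x in (0 : ℝ)..1, deriv G x * φ x = ∫ x in (0 : ℝ)..1, lift g x * φ x := by
      refine intervalIntegral.integral_congr_ae ?_
      filter_upwards [(intervalIntegrable_lift g).ae_hasDerivAt_integral] with x hx hx'
      rw [((hx (Set.uIoc_subset_uIcc hx') 0 (by simp)).sub_const c).deriv]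
    have e2 : φ 1 = φ 0 := by simpa using hp 0
    rw [e1, e2]
    simp [hG, hg0]
  have hq : hmem.toLp _ ∈ h1Submodule := ⟨hmean, g, hweak⟩
  exact ⟨(⟨hmem.toLp _, hq⟩ : h1Submodule), (hasWeakDeriv _).unique hweak⟩

instance : CompleteSpace H1 := by
  let D : H1 →ₗᵢ[ℝ] L2T := ⟨weakDeriv, fun _ => rfl⟩
  have hD : IsComplete (Set.range D) := by
    change IsComplete (Set.range weakDeriv)
    rw [range_weakDeriv]
    exact (completeSpace_coe_iff_isComplete (s := (H0 : Set L2T))).mp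
      (inferInstanceAs (CompleteSpace H0))
  have h := (D.isometry.isUniformInducing.isComplete_iff (s := Set.univ)).mp
    (by rwa [Set.image_univ])
  exact completeSpace_iff_isComplete_univ.mpr h

end H1

/-- The Ricci eigenvalue `ℰ = -v' - v²/m` with `v = 2q` (a function on `𝕋`, defined almost
everywhere). It is the eigenvalue in the direction `dx` of the Ricci tensor of the warped product
metric `dx² + r(x)² g_Y`, `m = dim Y`, `r'/r = v/m`. -/
def ricciEigenvalue (m : ℕ) (q : H1) (x : UnitAddCircle) : ℝ :=
  - H1.weakDeriv ((2 : ℝ) • q) x - (H1.toL2 ((2 : ℝ) • q) x) ^ 2 / m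

/-- The constant part `ℰ₀ = ∫ ℰ dx` of the Ricci eigenvalue. -/
def ricciConst (m : ℕ) (q : H1) : ℝ := ∫ x, ricciEigenvalue m q x

/-- The non-constant part `ℰ₁ = -v' - v²/m + (1/m) ∫ v² dx`, `v = 2q`, of the Ricci eigenvalue. -/
def ricciNonconst (m : ℕ) (q : H1) (x : UnitAddCircle) : ℝ :=
  - H1.weakDeriv ((2 : ℝ) • q) x - (H1.toL2 ((2 : ℝ) • q) x) ^ 2 / m
    + (1 / m) * ∫ t, (H1.toL2 ((2 : ℝ) • q) t) ^ 2

/-- The profile (radius of rotation) `r(x) = r₀ exp((2/m) ∫₀ˣ q(t) dt)`, a positive 1-periodic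
function on `ℝ`. -/
def profile (m : ℕ) (r₀ : ℝ) (q : H1) (x : ℝ) : ℝ :=
  r₀ * Real.exp ((2 / m) * ∫ t in (0 : ℝ)..x, lift (H1.toL2 q) t)

/-- The Gaussian curvature, in orthogonal coordinates, of the metric `A dx² + B dy²`:
`K = -(1 / (2 √(AB))) (∂ₓ(∂ₓB / √(AB)) + ∂_y(∂_yA / √(AB)))`. -/
def gaussianCurvature (A B : ℝ → ℝ → ℝ) (x y : ℝ) : ℝ :=
  -(1 / (2 * √(A x y * B x y))) *
    (deriv (fun s => deriv (fun s' => B s' y) s / √(A s y * B s y)) x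
      + deriv (fun t => deriv (fun t' => A x t') t / √(A x t * B x t)) y)

/-- The Gaussian curvature of the surface of rotation type `dx² + r(x)² dy²` with profile `r`. -/
def rotationalCurvature (r : ℝ → ℝ) (x y : ℝ) : ℝ :=
  gaussianCurvature (fun _ _ => 1) (fun s _ => r s ^ 2) x y

end PerturbedTorus

end

/-!
With `v = 2q`, the map `q ↦ ℰ₁` is the Riccati map `v ↦ -(v' + κ (v² - ∫ v²))`, `κ = 1/m`. As
`v' v²` is the derivative of `v³/3`, the two summands are orthogonal, which gives both estimates.

Differences and derivatives of the Riccati map are of the form `w ↦ w' + s w - ∫ s w` with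
`s ∈ 𝓗₀`. If `P' = s`, then `eᴾ (w' + s w) = (eᴾ w)'` is orthogonal to the constants; hence
`w' + s w` is controlled by its projection to `𝓗₀`, and `eᴾ w`, which vanishes somewhere, by
`w' + s w`. So these operators are isomorphisms, with inverses bounded in terms of `‖s‖`. The
Riccati map is therefore an injective local diffeomorphism with closed range, hence bijective, and
its inverse is analytic by the inverse function theorem.
-/

noncomputable section

namespace PerturbedTorus

/-! ### Inverting local diffeomorphisms globally -/

section GlobalInverse

open Filter Topology Set

section MetricSpace

variable {X Y : Type*} [MetricSpace X] [MetricSpace Y] {f : X → Y}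

/-- The local version of `AntilipschitzWith`, localized in the target: over a neighbourhood of each
point of `Y`, distances in `X` are controlled by distances of the images under `f`. -/
def LocallyAntilipschitz (f : X → Y) : Prop :=
  ∀ y, ∃ U ∈ 𝓝 y, ∃ K : ℝ, ∀ a ∈ f ⁻¹' U, ∀ b ∈ f ⁻¹' U, dist a b ≤ K * dist (f a) (f b)

theorem LocallyAntilipschitz.injective (h : LocallyAntilipschitz f) : Function.Injective f := by
  intro a b hab
  obtain ⟨U, hU, K, hK⟩ := h (f a)
  have ha : f a ∈ U := mem_of_mem_nhds hU
  have hdist := hK a ha b (hab ▸ ha : f b ∈ U)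
  rw [hab, dist_self, mul_zero] at hdist
  exact dist_le_zero.mp hdist

theorem LocallyAntilipschitz.isClosed_range [CompleteSpace X] (h : LocallyAntilipschitz f)
    (hf : Continuous f) : IsClosed (range f) := by
  refine isClosed_of_closure_subset fun y hy => ?_
  obtain ⟨u, hu, huy⟩ := mem_closure_iff_seq_limit.mp hy
  choose x hx using hu
  obtain ⟨U, hU, K, hK⟩ := h y
  have hfx : Tendsto (f ∘ x) atTop (𝓝 y) := by simpa only [Function.comp_def, hx] using huy
  have hxU : ∀ᶠ n in atTop, x n ∈ f ⁻¹' U := hfx.eventually hU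
  have hcauchy : CauchySeq x := by
    rw [cauchySeq_iff_tendsto_dist_atTop_0]
    have hlim : Tendsto (fun n : ℕ × ℕ => K * dist (f (x n.1)) (f (x n.2))) atTop (𝓝 0) := by
      simpa using (cauchySeq_iff_tendsto_dist_atTop_0.mp hfx.cauchySeq).const_mul K
    rw [← prod_atTop_atTop_eq] at hlim ⊢
    refine squeeze_zero' (.of_forall fun _ => dist_nonneg) ?_ hlim
    filter_upwards [hxU.prod_mk hxU] with n hn using hK _ hn.1 _ hn.2
  obtain ⟨a, ha⟩ := cauchySeq_tendsto_of_complete hcauchy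
  exact ⟨a, tendsto_nhds_unique ((hf.tendsto a).comp ha) hfx⟩

end MetricSpace

section NormedSpace

variable {𝕜 E F : Type*} [NormedAddCommGroup E] [CompleteSpace E] [NormedAddCommGroup F]

theorem LocallyAntilipschitz.bijective_of_hasStrictFDerivAt_equiv [NontriviallyNormedField 𝕜]
    [NormedSpace 𝕜 E] [NormedSpace 𝕜 F] [PreconnectedSpace F] {f : E → F} {f' : E → E ≃L[𝕜] F}
    (h : LocallyAntilipschitz f) (hf : ∀ x, HasStrictFDerivAt f (f' x : E →L[𝕜] F) x) :
    Function.Bijective f := by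
  have hcont : Continuous f := continuous_iff_continuousAt.mpr fun x => (hf x).continuousAt
  have hopen : IsOpen (range f) := (isOpenMap_of_hasStrictFDerivAt_equiv hf).isOpen_range
  exact ⟨h.injective,
    range_eq_univ.mp (IsClopen.eq_univ ⟨h.isClosed_range hcont, hopen⟩ (range_nonempty f))⟩

theorem analyticOnNhd_symm_of_hasStrictFDerivAt_equiv [RCLike 𝕜] [NormedSpace 𝕜 E]
    [NormedSpace 𝕜 F] {Φ : E ≃ F} {Φ' : E → E ≃L[𝕜] F} (hΦ : AnalyticOnNhd 𝕜 Φ univ)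
    (hΦ' : ∀ x, HasStrictFDerivAt Φ (Φ' x : E →L[𝕜] F) x) : AnalyticOnNhd 𝕜 Φ.symm univ := by
  intro y _
  obtain ⟨x, rfl⟩ := Φ.surjective y
  set e := (hΦ' x).toOpenPartialHomeomorph Φ
  have hinv : e.symm =ᶠ[𝓝 (Φ x)] Φ.symm := by
    filter_upwards [e.open_target.mem_nhds (hΦ' x).image_mem_toOpenPartialHomeomorph_target]
      with z hz
    exact Φ.eq_symm_apply.mpr (e.right_inv hz)
  exact (e.analyticAt_symm' (hΦ' x).mem_toOpenPartialHomeomorph_source (hΦ x (mem_univ x))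
    (hΦ' x).hasFDerivAt.fderiv).congr hinv

end NormedSpace

end GlobalInverse

/-! ### Multiplication by continuous functions -/

section Multiplication

open scoped ENNReal

variable {X : Type*} [TopologicalSpace X] [CompactSpace X] [MeasurableSpace X] [BorelSpace X]
  {μ : Measure X} [IsFiniteMeasure μ] {p : ℝ≥0∞}

/-- Multiplication of `L^p` functions by continuous functions, as a scalar action: it is the Hölder
multiplication by the class of `c` in `L^∞`. -/
instance : SMul C(X, ℝ) (Lp ℝ p μ) := ⟨fun c f => (ContinuousMap.toLp ∞ μ ℝ c • f :)⟩

theorem continuousMap_smul_def (c : C(X, ℝ)) (f : Lp ℝ p μ) :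
    c • f = (ContinuousMap.toLp ∞ μ ℝ c • f : Lp ℝ p μ) := rfl

theorem coeFn_continuousMap_smul (c : C(X, ℝ)) (f : Lp ℝ p μ) :
    (c • f : Lp ℝ p μ) =ᵐ[μ] fun x => c x * f x := by
  filter_upwards [Lp.coeFn_lpSMul (r := p) (ContinuousMap.toLp ∞ μ ℝ c) f,
    ContinuousMap.coeFn_toLp (p := ∞) (𝕜 := ℝ) μ c] with x hx hc
  rw [continuousMap_smul_def, hx, Pi.smul_apply', hc, smul_eq_mul]

instance : Module C(X, ℝ) (Lp ℝ p μ) where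
  one_smul f := by
    refine Lp.ext ?_
    filter_upwards [coeFn_continuousMap_smul 1 f] with x hx
    rw [hx, ContinuousMap.one_apply, one_mul]
  mul_smul c d f := by
    refine Lp.ext ?_
    filter_upwards [coeFn_continuousMap_smul (c * d) f, coeFn_continuousMap_smul c (d • f),
      coeFn_continuousMap_smul d f] with x hcd hc hd
    rw [hcd, hc, hd, ContinuousMap.mul_apply, mul_assoc]
  smul_zero c := Lp.smul_zero ..
  smul_add c f g := Lp.add_smul ..
  add_smul c d f := by simp only [continuousMap_smul_def, map_add, Lp.smul_add]
  zero_smul f := by simp only [continuousMap_smul_def, map_zero, Lp.zero_smul]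

instance : IsScalarTower ℝ C(X, ℝ) (Lp ℝ p μ) where
  smul_assoc a c f := by simp only [continuousMap_smul_def, map_smul, Lp.smul_assoc]

theorem norm_continuousMap_smul_le [Fact (1 ≤ p)] (c : C(X, ℝ)) (f : Lp ℝ p μ) :
    ‖c • f‖ ≤ ‖c‖ * ‖f‖ := by
  refine (Lp.norm_smul_le ..).trans ?_
  refine mul_le_mul_of_nonneg_right ?_ (norm_nonneg f)
  refine ((ContinuousMap.toLp ∞ μ ℝ).le_opNorm c).trans ?_
  grw [ContinuousMap.toLp_norm_le]
  simp

instance [Fact (1 ≤ p)] : IsBoundedSMul C(X, ℝ) (Lp ℝ p μ) :=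
  .of_norm_smul_le norm_continuousMap_smul_le

theorem inner_continuousMap_smul (c : C(X, ℝ)) (f g : Lp ℝ 2 μ) :
    inner ℝ (c • f) g = inner ℝ f (c • g) := by
  rw [L2.inner_def, L2.inner_def]
  refine integral_congr_ae ?_
  filter_upwards [coeFn_continuousMap_smul c f, coeFn_continuousMap_smul c g] with x hf hg
  simp only [hf, hg, RCLike.inner_apply, conj_trivial]
  ring

theorem mul_norm_sq_le_inner_smul {c : C(X, ℝ)} {a : ℝ} (h : ∀ x, a ≤ c x) (f : Lp ℝ 2 μ) :
    a * ‖f‖ ^ 2 ≤ inner ℝ (c • f) f := by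
  rw [← real_inner_self_eq_norm_sq, ← real_inner_smul_left, L2.inner_def, L2.inner_def]
  refine integral_mono_ae (L2.integrable_inner _ _) (L2.integrable_inner _ _) ?_
  filter_upwards [coeFn_continuousMap_smul c f, Lp.coeFn_smul a f] with x hc ha
  simp only [hc, ha, Pi.smul_apply, smul_eq_mul, RCLike.inner_apply, conj_trivial]
  nlinarith [h x, mul_nonneg (sub_nonneg.mpr (h x)) (mul_self_nonneg (f x))]

end Multiplication

section expComp

variable {X : Type*} [TopologicalSpace X]

/-- The continuous function `e^c`. -/
def expComp (c : C(X, ℝ)) : C(X, ℝ) :=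
  ⟨fun x => Real.exp (c x), by fun_prop⟩

theorem expComp_neg_mul_expComp (c : C(X, ℝ)) : expComp (-c) * expComp c = 1 := by
  ext x
  exact (Real.exp_add (-c x) (c x)).symm.trans (by rw [neg_add_cancel, Real.exp_zero]; rfl)

variable [CompactSpace X]

theorem exp_neg_norm_le_expComp (c : C(X, ℝ)) (x : X) : Real.exp (-‖c‖) ≤ expComp c x :=
  Real.exp_le_exp.mpr (neg_le_of_abs_le (c.norm_coe_le_norm x))

theorem norm_expComp_le (c : C(X, ℝ)) : ‖expComp c‖ ≤ Real.exp ‖c‖ := by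
  refine (ContinuousMap.norm_le _ (Real.exp_nonneg _)).mpr fun x => ?_
  exact (Real.norm_of_nonneg (Real.exp_nonneg (c x))).trans_le
    (Real.exp_le_exp.mpr (le_of_abs_le (c.norm_coe_le_norm x)))

end expComp

theorem exists_eq_integral {X : Type*} [TopologicalSpace X] [CompactSpace X] [PreconnectedSpace X]
    [MeasurableSpace X] [OpensMeasurableSpace X] (μ : Measure X) [IsProbabilityMeasure μ]
    (c : C(X, ℝ)) : ∃ z, c z = ∫ x, c x ∂μ := by
  have hint : Integrable c μ := c.continuous.integrable_of_hasCompactSupport (.of_compactSpace _)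
  exact mem_range_of_exists_le_of_exists_ge c.continuous (exists_le_integral hint)
    (exists_integral_le hint)

theorem absolutelyContinuousOnInterval_comp_of_lipschitzOnWith {Y Z : Type*} [PseudoMetricSpace Y]
    [PseudoMetricSpace Z] {f : ℝ → Y} {φ : Y → Z} {K : NNReal} {s : Set Y} {a b : ℝ}
    (hφ : LipschitzOnWith K φ s) (hfs : Set.MapsTo f (Set.uIcc a b) s)
    (hf : AbsolutelyContinuousOnInterval f a b) :
    AbsolutelyContinuousOnInterval (fun x => φ (f x)) a b := by
  have hlim := Filter.Tendsto.const_mul (K : ℝ) hf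
  rw [mul_zero] at hlim
  refine squeeze_zero' (.of_forall fun E => Finset.sum_nonneg fun i _ => dist_nonneg) ?_ hlim
  filter_upwards [Filter.mem_inf_of_right (Filter.mem_principal_self _)] with E hE
  rw [Finset.mul_sum]
  exact Finset.sum_le_sum fun i hi =>
    hφ.dist_le_mul _ (hfs (hE.1 i hi).1) _ (hfs (hE.1 i hi).2)

/-! ### Primitives on the circle -/

theorem lift_periodic (f : L2T) : Function.Periodic (lift f) 1 := fun x => by
  simp only [lift, AddCircle.coe_add_period]

theorem intervalIntegrable_lift_of_endpoints (f : L2T) (a b : ℝ) :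
    IntervalIntegrable (lift f) volume a b :=
  (lift_periodic f).intervalIntegrable₀ one_ne_zero (intervalIntegrable_lift f) a b

theorem locallyIntegrable_lift (f : L2T) : LocallyIntegrable (lift f) volume := by
  rw [locallyIntegrable_iff]
  intro K hK
  obtain ⟨R, hR⟩ := hK.isBounded.subset_closedBall 0
  refine IntegrableOn.mono_set ?_ hR
  rw [Real.closedBall_eq_Icc, integrableOn_Icc_iff_integrableOn_Ioc]
  exact (intervalIntegrable_lift_of_endpoints f _ _).1

theorem exists_mem_Ioc_coe_eq (x : UnitAddCircle) :
    ∃ y ∈ Set.Ioc (0 : ℝ) 1, (y : UnitAddCircle) = x := by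
  have hmem := (AddCircle.equivIoc (1 : ℝ) 0 x).2
  exact ⟨_, ⟨hmem.1, hmem.2.trans_eq (zero_add 1)⟩,
    (AddCircle.equivIoc (1 : ℝ) 0).symm_apply_apply x⟩

theorem ae_coe_iff {Q : UnitAddCircle → Prop} :
    (∀ᵐ x : ℝ, Q (x : UnitAddCircle)) ↔ ∀ᵐ x : UnitAddCircle, Q x := by
  constructor
  · intro h
    have hIoc : ∀ᵐ x : Set.Ioc (0 : ℝ) (0 + 1) ∂(Measure.comap Subtype.val volume),
        Q ((x : ℝ) : UnitAddCircle) :=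
      (measurePreserving_subtype_coe measurableSet_Ioc).quasiMeasurePreserving.ae
        (ae_restrict_of_ae h)
    filter_upwards [(AddCircle.measurePreserving_equivIoc
      (T := 1) (a := 0)).quasiMeasurePreserving.ae hIoc] with x hx
    rwa [show ((AddCircle.equivIoc (1 : ℝ) 0 x : ℝ) : UnitAddCircle) = x from
      (AddCircle.equivIoc (1 : ℝ) 0).symm_apply_apply x] at hx
  · intro h
    have hIoc (n : ℤ) : ∀ᵐ x : ℝ, x ∈ Set.Ioc (n : ℝ) (n + 1) → Q (x : UnitAddCircle) :=
      (ae_restrict_iff' measurableSet_Ioc).mp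
        ((UnitAddCircle.measurePreserving_mk n).quasiMeasurePreserving.ae h)
    filter_upwards [ae_all_iff.mpr hIoc] with x hx
    refine hx (⌈x⌉ - 1) ⟨?_, ?_⟩ <;> push_cast
    · linarith [Int.ceil_lt_add_one x]
    · linarith [Int.le_ceil x]

instance : IsProbabilityMeasure (volume : Measure UnitAddCircle) :=
  ⟨UnitAddCircle.measure_univ⟩

/-- The constant function `1` in `L²(𝕋)`. -/
abbrev oneL2 : L2T := Lp.const 2 volume 1

theorem norm_oneL2 : ‖oneL2‖ = 1 := by
  rw [Lp.norm_const] <;> simp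

theorem integral_abs_le_norm (f : L2T) : ∫ x, |f x| ≤ ‖f‖ := by
  calc ∫ x, |f x| = ∫ x, (|f| : L2T) x :=
        integral_congr_ae ((Lp.coeFn_abs f).mono fun x hx => hx.symm)
    _ = inner ℝ oneL2 |f| := integral_eq_inner_one _
    _ ≤ ‖oneL2‖ * ‖|f|‖ := real_inner_le_norm _ _
    _ = ‖f‖ := by rw [norm_oneL2, one_mul, norm_abs_eq_norm]

theorem abs_integral_lift_le_norm (f : L2T) {a b : ℝ} (ha : a ∈ Set.Ioc (0 : ℝ) 1)
    (hb : b ∈ Set.Ioc (0 : ℝ) 1) : |∫ x in a..b, lift f x| ≤ ‖f‖ := by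
  have hsub : Set.uIoc a b ⊆ Set.Ioc 0 1 := Set.Ioc_subset_Ioc (le_min ha.1.le hb.1.le)
    (max_le ha.2 hb.2)
  calc |∫ x in a..b, lift f x| ≤ ∫ x in Set.uIoc a b, ‖lift f x‖ :=
        intervalIntegral.norm_integral_le_integral_norm_uIoc (f := lift f)
    _ ≤ ∫ x in Set.Ioc (0 : ℝ) 1, ‖lift f x‖ :=
        setIntegral_mono_set (intervalIntegrable_lift f).1.norm
          (.of_forall fun _ => abs_nonneg _) (.of_forall hsub)
    _ = ∫ x, |f x| := by
        have h := UnitAddCircle.integral_preimage 0 fun x => |f x|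
        rwa [zero_add] at h
    _ ≤ ‖f‖ := integral_abs_le_norm f

theorem coeFn_smul_oneL2 (c : C(UnitAddCircle, ℝ)) : c • oneL2 =ᵐ[volume] c := by
  filter_upwards [coeFn_continuousMap_smul c oneL2,
    Lp.coeFn_const (p := 2) (μ := (volume : Measure UnitAddCircle)) (1 : ℝ)] with x hx h1
  rw [hx, h1, Function.const_apply, mul_one]

theorem smul_oneL2_injective :
    Function.Injective fun c : C(UnitAddCircle, ℝ) => c • oneL2 := by
  intro c d (hcd : c • oneL2 = d • oneL2)
  refine DFunLike.coe_injective ((c.continuous.ae_eq_iff_eq volume d.continuous).mp ?_)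
  exact (coeFn_smul_oneL2 c).symm.trans (hcd ▸ coeFn_smul_oneL2 d)

/-- The continuous function `c` on the circle is a primitive of `g ∈ L²(𝕋)`. In terms of classes,
`g` is the weak derivative of `c`; the integral form keeps the pointwise values of `c`. -/
def IsPrimitive (c : C(UnitAddCircle, ℝ)) (g : L2T) : Prop :=
  ∀ a b : ℝ, ∫ x in a..b, lift g x = c b - c a

namespace IsPrimitive

variable {c d : C(UnitAddCircle, ℝ)} {g h : L2T}

theorem ae_hasDerivAt (hc : IsPrimitive c g) :
    ∀ᵐ x : ℝ, HasDerivAt (fun y : ℝ => c y) (lift g x) x := by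
  filter_upwards [LocallyIntegrable.ae_hasDerivAt_integral (locallyIntegrable_lift g)] with x hx
  have hcx : (fun y : ℝ => c y) = fun y : ℝ => (∫ t in (0 : ℝ)..y, lift g t) + c (0 : ℝ) :=
    funext fun y => by rw [hc 0 y, sub_add_cancel]
  rw [hcx]
  exact (hx 0).add_const _

theorem absolutelyContinuousOnInterval (hc : IsPrimitive c g) (a b : ℝ) :
    AbsolutelyContinuousOnInterval (fun y : ℝ => c y) a b := by
  have hcx : (fun y : ℝ => c y) = fun y : ℝ => (∫ t in a..y, lift g t) + c a :=
    funext fun y => by rw [hc a y, sub_add_cancel]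
  rw [hcx]
  have hint := intervalIntegrable_lift_of_endpoints g a b
  exact (hint.absolutelyContinuousOnInterval_intervalIntegral Set.left_mem_uIcc).fun_add
    (ContDiffOn.absolutelyContinuousOnInterval contDiffOn_const)

theorem of_ae_hasDerivAt
    (hac : ∀ a b, AbsolutelyContinuousOnInterval (fun y : ℝ => c y) a b)
    (hderiv : ∀ᵐ x : ℝ, HasDerivAt (fun y : ℝ => c y) (lift g x) x) : IsPrimitive c g := by
  intro a b
  rw [← (hac a b).integral_deriv_eq_sub]
  refine intervalIntegral.integral_congr_ae ?_
  filter_upwards [hderiv] with x hx _ using hx.deriv.symm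

theorem integral_eq_zero (hc : IsPrimitive c g) : ∫ x, g x = 0 := by
  rw [← integral_lift, hc 0 1, AddCircle.coe_period, QuotientAddGroup.mk_zero, sub_self]

theorem inner_one (hc : IsPrimitive c g) : inner ℝ oneL2 g = 0 := by
  rw [← integral_eq_inner_one, hc.integral_eq_zero]

theorem add_const (hc : IsPrimitive c g) (k : ℝ) : IsPrimitive (c + .const _ k) g := fun a b => by
  rw [hc a b, ContinuousMap.add_apply, ContinuousMap.add_apply, ContinuousMap.const_apply,
    ContinuousMap.const_apply, add_sub_add_right_eq_sub]

theorem neg (hc : IsPrimitive c g) : IsPrimitive (-c) (-g) := by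
  refine of_ae_hasDerivAt (fun a b => (hc.absolutelyContinuousOnInterval a b).fun_neg) ?_
  filter_upwards [hc.ae_hasDerivAt, ae_coe_iff.mpr (Lp.coeFn_neg g)] with x hcx hneg
  rw [lift, hneg, Pi.neg_apply]
  exact hcx.fun_neg

theorem mul (hc : IsPrimitive c g) (hd : IsPrimitive d h) :
    IsPrimitive (c * d) (d • g + c • h) := by
  refine of_ae_hasDerivAt (fun a b => (hc.absolutelyContinuousOnInterval a b).fun_mul
    (hd.absolutelyContinuousOnInterval a b)) ?_
  filter_upwards [hc.ae_hasDerivAt, hd.ae_hasDerivAt, ae_coe_iff.mpr (Lp.coeFn_add (d • g) (c • h)),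
    ae_coe_iff.mpr (coeFn_continuousMap_smul d g), ae_coe_iff.mpr (coeFn_continuousMap_smul c h)]
    with x hcx hdx hadd hdg hch
  rw [lift, hadd, Pi.add_apply, hdg, hch, mul_comm (d _)]
  exact hcx.fun_mul hdx

theorem exp (hc : IsPrimitive c g) : IsPrimitive (expComp c) (expComp c • g) := by
  obtain ⟨K, hK⟩ : ∃ K, LipschitzOnWith K Real.exp (Metric.closedBall 0 ‖c‖) :=
    Real.contDiff_exp.contDiffOn.exists_lipschitzOnWith one_ne_zero (convex_closedBall 0 _)
      (isCompact_closedBall 0 _)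
  have hmaps (y : ℝ) : c y ∈ Metric.closedBall 0 ‖c‖ :=
    mem_closedBall_zero_iff.mpr (c.norm_coe_le_norm y)
  have hexp : (fun y : ℝ => expComp c y) = fun y : ℝ => Real.exp (c y) := rfl
  refine of_ae_hasDerivAt (fun a b => ?_) ?_
  · rw [hexp]
    exact absolutelyContinuousOnInterval_comp_of_lipschitzOnWith hK (fun y _ => hmaps y)
      (hc.absolutelyContinuousOnInterval a b)
  · rw [hexp]
    filter_upwards [hc.ae_hasDerivAt,
      ae_coe_iff.mpr (coeFn_continuousMap_smul (expComp c) g)] with x hcx hsmul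
    rw [lift, hsmul]
    exact hcx.exp

theorem norm_le (hc : IsPrimitive c g) {z : UnitAddCircle} (hz : c z = 0) : ‖c‖ ≤ ‖g‖ := by
  obtain ⟨a, ha, rfl⟩ := exists_mem_Ioc_coe_eq z
  refine (ContinuousMap.norm_le _ (norm_nonneg g)).mpr fun y => ?_
  obtain ⟨b, hb, rfl⟩ := exists_mem_Ioc_coe_eq y
  calc ‖c b‖ = |∫ x in a..b, lift g x| := by rw [hc a b, hz, sub_zero, Real.norm_eq_abs]
    _ ≤ ‖g‖ := abs_integral_lift_le_norm g ha hb

theorem hasWeakDeriv (hc : IsPrimitive c g) : HasWeakDeriv (c • oneL2) g := by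
  intro φ hφ hper
  have hφac : AbsolutelyContinuousOnInterval φ 0 1 :=
    ContDiffOn.absolutelyContinuousOnInterval (hφ.of_le (by simp)).contDiffOn
  have hlift : ∀ᵐ x : ℝ, lift (c • oneL2) x = c x := ae_coe_iff.mpr (coeFn_smul_oneL2 c)
  have hc01 : c (1 : ℝ) = c (0 : ℝ) := by rw [AddCircle.coe_period, QuotientAddGroup.mk_zero]
  calc ∫ x in (0 : ℝ)..1, lift (c • oneL2) x * deriv φ x
      = ∫ x in (0 : ℝ)..1, c x * deriv φ x :=
        intervalIntegral.integral_congr_ae (by filter_upwards [hlift] with x hx _; rw [hx])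
    _ = - ∫ x in (0 : ℝ)..1, deriv (fun y : ℝ => c y) x * φ x := by
        rw [(hc.absolutelyContinuousOnInterval 0 1).integral_mul_deriv_eq_deriv_mul hφac,
          hc01, hper.eq, sub_self, zero_sub]
    _ = - ∫ x in (0 : ℝ)..1, lift g x * φ x := by
        congr 1
        refine intervalIntegral.integral_congr_ae ?_
        filter_upwards [hc.ae_hasDerivAt] with x hx _
        rw [hx.deriv]

end IsPrimitive

theorem exists_isPrimitive {g : L2T} (hg : g ∈ H0) :
    ∃ c : C(UnitAddCircle, ℝ), IsPrimitive c g ∧ ∫ x, c x = 0 ∧ ‖c‖ ≤ ‖g‖ := by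
  have hint := intervalIntegrable_lift_of_endpoints g
  have hper : Function.Periodic (fun x : ℝ => ∫ t in (0 : ℝ)..x, lift g t) 1 := fun x => by
    beta_reduce
    rw [← intervalIntegral.integral_add_adjacent_intervals (hint 0 x) (hint x (x + 1)),
      (lift_periodic g).intervalIntegral_add_eq x 0, zero_add, integral_lift, mem_H0.mp hg,
      add_zero]
  let G : C(UnitAddCircle, ℝ) :=
    ⟨hper.lift, continuous_coinduced_dom.mpr (intervalIntegral.continuous_primitive hint 0)⟩
  have hG : IsPrimitive G g := fun a b =>
    (intervalIntegral.integral_interval_sub_left (hint 0 b) (hint 0 a)).symm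
  obtain ⟨z, hz⟩ := exists_eq_integral volume G
  have hmean : ∫ x, (G + .const _ (-G z)) x = 0 := by
    have hGint : Integrable G := G.continuous.integrable_of_hasCompactSupport (.of_compactSpace _)
    simp only [ContinuousMap.add_apply, ContinuousMap.const_apply]
    rw [integral_add hGint (integrable_const _), integral_const, probReal_univ, one_smul, ← hz,
      add_neg_cancel]
  exact ⟨_, hG.add_const (-G z), hmean, (hG.add_const (-G z)).norm_le (add_neg_cancel (G z))⟩

theorem integral_smul_oneL2 (c : C(UnitAddCircle, ℝ)) : ∫ x, (c • oneL2) x = ∫ x, c x :=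
  integral_congr_ae (coeFn_smul_oneL2 c)

/-- The orthogonal projection `f ↦ f - ∫ f` of `L²(𝕋)` onto `𝓗₀`. -/
def removeMean : L2T →L[ℝ] H0 := H0.orthogonalProjectionOnto

theorem inner_removeMean (f : L2T) (h : H0) : inner ℝ h (removeMean f) = inner ℝ (h : L2T) f :=
  Submodule.inner_orthogonalProjectionOnto_eq_of_mem_left h f

theorem removeMean_coe (f : H0) : removeMean f = f :=
  H0.orthogonalProjectionOnto_mem_subspace_eq_self f

theorem removeMean_const_smul_oneL2 (t : ℝ) : removeMean (t • oneL2) = 0 := by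
  refine H0.orthogonalProjectionOnto_apply_of_mem_orthogonal fun f hf => ?_
  rw [inner_smul_right, real_inner_comm, ← integral_eq_inner_one, mem_H0.mp hf, mul_zero]

theorem removeMean_add_const_smul_oneL2 (f : L2T) (t : ℝ) :
    removeMean (f + t • oneL2) = removeMean f := by
  rw [map_add, removeMean_const_smul_oneL2, add_zero]

theorem coe_removeMean (f : L2T) : (removeMean f : L2T) = f - (∫ x, f x) • oneL2 := by
  have hmem : f - (∫ x, f x) • oneL2 ∈ H0 := by
    rw [mem_H0, integral_eq_inner_one, inner_sub_right, inner_smul_right,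
      real_inner_self_eq_norm_sq, norm_oneL2, ← integral_eq_inner_one]
    ring
  have h := removeMean_add_const_smul_oneL2 (f - (∫ x, f x) • oneL2) (∫ x, f x)
  rw [sub_add_cancel, removeMean_coe ⟨_, hmem⟩] at h
  rw [h]

theorem norm_removeMean_sq (f : L2T) : ‖removeMean f‖ ^ 2 = ‖f‖ ^ 2 - (∫ x, f x) ^ 2 := by
  rw [← real_inner_self_eq_norm_sq, inner_removeMean, coe_removeMean, inner_sub_left,
    real_inner_self_eq_norm_sq, real_inner_smul_left, ← integral_eq_inner_one, sq (∫ x, f x)]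

namespace H1

theorem exists_of_isPrimitive {c : C(UnitAddCircle, ℝ)} {g : L2T} (hc : IsPrimitive c g)
    (h0 : ∫ x, c x = 0) : ∃ q : H1, toL2 q = c • oneL2 ∧ weakDeriv q = g := by
  have hmem : c • oneL2 ∈ h1Submodule :=
    ⟨(integral_smul_oneL2 c).trans h0, g, hc.hasWeakDeriv⟩
  let q : H1 := (⟨c • oneL2, hmem⟩ : h1Submodule)
  exact ⟨q, rfl, (hasWeakDeriv q).unique hc.hasWeakDeriv⟩

theorem exists_isPrimitive_weakDeriv (q : H1) : ∃ c : C(UnitAddCircle, ℝ),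
    c • oneL2 = toL2 q ∧ IsPrimitive c (weakDeriv q) ∧ ‖c‖ ≤ ‖q‖ := by
  obtain ⟨c, hc, h0, hnorm⟩ := exists_isPrimitive (integral_weakDeriv q)
  obtain ⟨p, hp, hp'⟩ := exists_of_isPrimitive hc h0
  exact ⟨c, by rw [← hp, weakDeriv_injective hp'], hc, hnorm⟩

/-- The Sobolev embedding `𝓗₁ → C(𝕋)`: the continuous representative of an element of `𝓗₁`. -/
def toContinuous : H1 →L[ℝ] C(UnitAddCircle, ℝ) :=
  have hrep (q : H1) := (exists_isPrimitive_weakDeriv q).choose_spec.1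
  LinearMap.mkContinuous
    { toFun := fun q => (exists_isPrimitive_weakDeriv q).choose
      map_add' := fun p q => smul_oneL2_injective <| by
        beta_reduce
        rw [add_smul, hrep (p + q), hrep p, hrep q, map_add]
      map_smul' := fun a q => smul_oneL2_injective <| by
        beta_reduce
        rw [RingHom.id_apply, smul_assoc, hrep (a • q), hrep q, map_smul] }
    1 fun q => (exists_isPrimitive_weakDeriv q).choose_spec.2.2.trans_eq (one_mul ‖q‖).symm

theorem toContinuous_smul_oneL2 (q : H1) : toContinuous q • oneL2 = toL2 q :=
  (exists_isPrimitive_weakDeriv q).choose_spec.1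

theorem isPrimitive_toContinuous (q : H1) : IsPrimitive (toContinuous q) (weakDeriv q) :=
  (exists_isPrimitive_weakDeriv q).choose_spec.2.1

theorem norm_toContinuous_le (q : H1) : ‖toContinuous q‖ ≤ ‖q‖ :=
  (exists_isPrimitive_weakDeriv q).choose_spec.2.2

theorem coeFn_toL2 (q : H1) : toL2 q =ᵐ[volume] toContinuous q := by
  rw [← toContinuous_smul_oneL2]
  exact coeFn_smul_oneL2 _

theorem norm_toL2_le (q : H1) : ‖toL2 q‖ ≤ ‖q‖ := by
  calc ‖toL2 q‖ ≤ ‖toContinuous q‖ * ‖oneL2‖ := by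
        rw [← toContinuous_smul_oneL2]; exact norm_smul_le _ _
    _ ≤ ‖q‖ := by rw [norm_oneL2, mul_one]; exact norm_toContinuous_le q

theorem exists_toContinuous_eq_zero (q : H1) : ∃ z, toContinuous q z = 0 := by
  obtain ⟨z, hz⟩ := exists_eq_integral volume (toContinuous q)
  refine ⟨z, ?_⟩
  rw [hz, ← integral_smul_oneL2, toContinuous_smul_oneL2, integral_toL2]

/-- The inclusion `𝓗₁ → 𝓗₀`. -/
def toH0 : H1 →ₗ[ℝ] H0 := toL2.codRestrict H0 integral_toL2

/-- The derivative, as an isometric isomorphism of `𝓗₁` onto `𝓗₀`. -/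
def derivEquiv : H1 ≃ₗᵢ[ℝ] H0 :=
  LinearIsometryEquiv.ofSurjective
    { toLinearMap := weakDeriv.codRestrict H0 integral_weakDeriv
      norm_map' := fun _ => rfl }
    fun g => (range_weakDeriv.ge g.2).imp fun _ hq => Subtype.ext hq

theorem coe_derivEquiv (q : H1) : (derivEquiv q : L2T) = weakDeriv q := rfl

end H1

/-! ### The linearized Riccati operator -/

theorem norm_le_mul_norm_removeMean {p : C(UnitAddCircle, ℝ)} {a : ℝ} (ha : 0 < a)
    (hp : ∀ x, a ≤ p x) {g : L2T} (hg : p • g ∈ H0) :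
    ‖g‖ ≤ a⁻¹ * ‖p‖ * ‖removeMean g‖ := by
  have hpair : a * ‖g‖ ^ 2 ≤ ‖p‖ * ‖removeMean g‖ * ‖g‖ := by
    calc a * ‖g‖ ^ 2 ≤ inner ℝ (p • g) g := mul_norm_sq_le_inner_smul hp g
      _ = inner ℝ ⟨p • g, hg⟩ (removeMean g) := (inner_removeMean g ⟨p • g, hg⟩).symm
      _ ≤ ‖p • g‖ * ‖removeMean g‖ := real_inner_le_norm _ _
      _ ≤ ‖p‖ * ‖removeMean g‖ * ‖g‖ := by grw [norm_smul_le]; exact (mul_right_comm _ _ _).le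
  rcases (norm_nonneg g).eq_or_lt with h0 | hpos
  · rw [← h0]
    positivity
  · rw [mul_assoc, ← div_eq_inv_mul, le_div_iff₀ ha]
    nlinarith

theorem exists_smul_add_const_mem_H0 {p : C(UnitAddCircle, ℝ)} {a : ℝ} (ha : 0 < a)
    (hp : ∀ x, a ≤ p x) (f : L2T) : ∃ t : ℝ, p • (f + t • oneL2) ∈ H0 := by
  have hpos : inner ℝ oneL2 (p • oneL2) ≠ 0 := by
    have h := mul_norm_sq_le_inner_smul hp oneL2
    rw [norm_oneL2, real_inner_comm] at h
    linarith
  refine ⟨-(inner ℝ oneL2 (p • f) / inner ℝ oneL2 (p • oneL2)), ?_⟩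
  rw [mem_H0, integral_eq_inner_one, smul_add, inner_add_right, smul_comm, inner_smul_right,
    neg_mul, div_mul_cancel₀ _ hpos, add_neg_cancel]

namespace H1

/-- The operator `w ↦ w' + s w - ∫ s w` from `𝓗₁` to `𝓗₀`. Up to sign, it is the
derivative at `v` of the Riccati map when `s = 2 κ v`. -/
def riccatiLin (s : H0) : H1 →L[ℝ] H0 :=
  derivEquiv.toContinuousLinearEquiv + removeMean ∘L
    (ContinuousLinearMap.lsmul ℝ C(UnitAddCircle, ℝ)).flip (s : L2T) ∘L toContinuous

theorem riccatiLin_apply (s : H0) (w : H1) :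
    riccatiLin s w = derivEquiv w + removeMean (toContinuous w • (s : L2T)) := rfl

theorem riccatiLin_eq_removeMean (s : H0) (w : H1) :
    riccatiLin s w = removeMean (weakDeriv w + toContinuous w • (s : L2T)) := by
  rw [riccatiLin_apply, map_add, ← coe_derivEquiv, removeMean_coe]

theorem isPrimitive_expComp_mul {P : C(UnitAddCircle, ℝ)} {s : L2T} (hP : IsPrimitive P s)
    (w : H1) : IsPrimitive (expComp P * toContinuous w)
      (expComp P • (weakDeriv w + toContinuous w • s)) := by
  rw [smul_add, add_comm, smul_comm]
  exact hP.exp.mul (isPrimitive_toContinuous w)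

/-- The bound of the inverse of `riccatiLin s` for `‖s‖ ≤ R`. -/
def riccatiLinBound (R : ℝ) : ℝ := (1 + Real.exp (2 * R) * R) * Real.exp (2 * R)

theorem norm_le_mul_norm_riccatiLin {s : H0} {R : ℝ} (hs : ‖s‖ ≤ R) (w : H1) :
    ‖w‖ ≤ riccatiLinBound R * ‖riccatiLin s w‖ := by
  obtain ⟨P, hP, -, hPs⟩ := exists_isPrimitive s.2
  replace hPs : ‖P‖ ≤ R := hPs.trans hs
  set W := toContinuous w
  set g := weakDeriv w + W • (s : L2T) with hg
  have hpW : IsPrimitive (expComp P * W) (expComp P • g) := isPrimitive_expComp_mul hP w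
  have hexp : Real.exp (2 * R) = Real.exp R * Real.exp R := by rw [two_mul, Real.exp_add]
  have hp : ‖expComp P‖ ≤ Real.exp R := (norm_expComp_le P).trans (Real.exp_le_exp.mpr hPs)
  have hp' : ‖expComp (-P)‖ ≤ Real.exp R :=
    (norm_expComp_le (-P)).trans (Real.exp_le_exp.mpr ((norm_neg P).trans_le hPs))
  have hgbound : ‖g‖ ≤ Real.exp (2 * R) * ‖riccatiLin s w‖ := by
    have h := norm_le_mul_norm_removeMean (Real.exp_pos _) (exp_neg_norm_le_expComp P)
      hpW.integral_eq_zero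
    rw [Real.exp_neg, inv_inv, ← riccatiLin_eq_removeMean] at h
    grw [h, hp, hPs, hexp]
  have hWbound : ‖W‖ ≤ Real.exp (2 * R) * ‖g‖ := by
    obtain ⟨z, hz⟩ := exists_toContinuous_eq_zero w
    calc ‖W‖ = ‖expComp (-P) * (expComp P * W)‖ := by
          rw [← mul_assoc, expComp_neg_mul_expComp, one_mul]
      _ ≤ ‖expComp (-P)‖ * ‖expComp P • g‖ := by
          grw [norm_mul_le, hpW.norm_le (z := z) (mul_eq_zero_of_right _ hz)]
      _ ≤ Real.exp (2 * R) * ‖g‖ := by grw [norm_smul_le, hp', hp, hexp, mul_assoc]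
  calc ‖w‖ = ‖g - W • (s : L2T)‖ := by rw [hg, add_sub_cancel_right, norm_def]
    _ ≤ ‖g‖ + ‖W‖ * ‖s‖ := by grw [norm_sub_le, norm_smul_le, Submodule.coe_norm]
    _ ≤ (1 + Real.exp (2 * R) * R) * ‖g‖ := by grw [hWbound, hs]; exact le_of_eq (by ring)
    _ ≤ riccatiLinBound R * ‖riccatiLin s w‖ := by
        have hR : 0 ≤ R := (norm_nonneg s).trans hs
        grw [hgbound, riccatiLinBound, mul_assoc]

theorem riccatiLin_surjective (s : H0) : Function.Surjective (riccatiLin s) := by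
  -- Variation of constants: `W = e⁻ᴾ (U + k)` solves `W' + s W = f + t` when `P' = s` and
  -- `U' = eᴾ (f + t)`; the constant `t` makes `U` periodic and `k` gives `W` mean zero.
  intro f
  obtain ⟨P, hP, -⟩ := exists_isPrimitive s.2
  set p := expComp P
  set r := expComp (-P)
  have hrp : r * p = 1 := expComp_neg_mul_expComp P
  obtain ⟨t, ht⟩ := exists_smul_add_const_mem_H0 (Real.exp_pos _) (exp_neg_norm_le_expComp P) f
  obtain ⟨U, hU, -⟩ := exists_isPrimitive ht
  obtain ⟨k, hk⟩ := exists_smul_add_const_mem_H0 (Real.exp_pos _) (exp_neg_norm_le_expComp (-P))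
    (U • oneL2)
  set W := r * (U + .const _ k)
  have hW : IsPrimitive W (f + t • oneL2 - W • (s : L2T)) := by
    have h := hP.neg.exp.mul (hU.add_const k)
    convert h using 1
    rw [smul_smul r, hrp, one_smul, smul_smul, smul_neg, mul_comm (U + _) r]
    abel
  have hW0 : ∫ x, W x = 0 := by
    rw [← integral_smul_oneL2, mul_smul, add_smul]
    rwa [← algebraMap_smul C(UnitAddCircle, ℝ) k oneL2] at hk
  obtain ⟨w, hw, hw'⟩ := exists_of_isPrimitive hW hW0
  have hwW : toContinuous w = W :=
    smul_oneL2_injective ((toContinuous_smul_oneL2 w).trans hw)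
  refine ⟨w, ?_⟩
  rw [riccatiLin_eq_removeMean, hw', hwW, sub_add_cancel, removeMean_add_const_smul_oneL2,
    removeMean_coe]

theorem riccatiLin_injective (s : H0) : Function.Injective (riccatiLin s) := by
  rw [injective_iff_map_eq_zero]
  intro w hw
  have h := norm_le_mul_norm_riccatiLin le_rfl w (s := s)
  rwa [hw, norm_zero, mul_zero, norm_le_zero_iff] at h

/-- `riccatiLin s` as an isomorphism. -/
def riccatiLinEquiv (s : H0) : H1 ≃L[ℝ] H0 :=
  .ofBijective (riccatiLin s) (LinearMap.ker_eq_bot.mpr (riccatiLin_injective s))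
    (LinearMap.range_eq_top.mpr (riccatiLin_surjective s))

end H1

/-! ### The Riccati map -/

namespace H1

variable (κ : ℝ) (v w : H1)

/-- The inclusion `c ↦ c • 1` of the continuous functions into `L²(𝕋)`. -/
def smulOneL2 : C(UnitAddCircle, ℝ) →L[ℝ] L2T :=
  (ContinuousLinearMap.lsmul ℝ C(UnitAddCircle, ℝ)).flip oneL2

/-- The class of `v²` in `L²(𝕋)`. -/
def sqL2 : L2T := (toContinuous v * toContinuous v) • oneL2

/-- The Riccati map `v ↦ -(v' + κ (v² - ∫ v²))` from `𝓗₁` to `𝓗₀`. -/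
def riccati : H0 :=
  -(derivEquiv v + κ • removeMean (sqL2 v))

theorem integral_sqL2 :
    ∫ x, sqL2 v x = ‖toL2 v‖ ^ 2 := by
  rw [integral_eq_inner_one, sqL2, mul_smul, ← inner_continuousMap_smul, toContinuous_smul_oneL2,
    real_inner_self_eq_norm_sq]

theorem norm_sqL2_le :
    ‖sqL2 v‖ ≤ ‖weakDeriv v‖ * ‖toL2 v‖ := by
  rw [sqL2, mul_smul, toContinuous_smul_oneL2]
  grw [norm_smul_le, norm_toContinuous_le, norm_def]

theorem inner_weakDeriv_sqL2 :
    inner ℝ (weakDeriv v) (sqL2 v) = 0 := by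
  have hV := isPrimitive_toContinuous v
  -- `3 v² v'` is the derivative of `v³`.
  have hcube := (hV.mul (hV.mul hV)).inner_one
  simp only [smul_add, smul_smul, inner_add_right] at hcube
  rw [sqL2, ← inner_continuousMap_smul, real_inner_comm]
  linarith

theorem norm_riccati_sq : ‖riccati κ v‖ ^ 2 = ‖weakDeriv v‖ ^ 2
    + κ ^ 2 * ‖removeMean (sqL2 v)‖ ^ 2 := by
  have horth : inner ℝ (derivEquiv v)
      (κ • removeMean (sqL2 v)) = 0 := by
    refine (real_inner_smul_right (derivEquiv v) (removeMean (sqL2 v)) κ).trans ?_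
    rw [inner_removeMean, coe_derivEquiv, inner_weakDeriv_sqL2, mul_zero]
  rw [riccati, norm_neg, sq, norm_add_sq_eq_norm_sq_add_norm_sq_real horth, ← sq, ← sq, norm_smul,
    mul_pow, Real.norm_eq_abs, sq_abs, LinearIsometryEquiv.norm_map, norm_def]

theorem norm_weakDeriv_sq_le_norm_riccati_sq : ‖weakDeriv v‖ ^ 2 ≤ ‖riccati κ v‖ ^ 2 := by
  rw [norm_riccati_sq]
  exact le_add_of_nonneg_right (by positivity)

theorem norm_le_norm_riccati : ‖v‖ ≤ ‖riccati κ v‖ :=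
  (sq_le_sq₀ (norm_nonneg v) (norm_nonneg _)).mp (norm_weakDeriv_sq_le_norm_riccati_sq κ v)

theorem norm_riccati_sq_le : ‖riccati κ v‖ ^ 2 ≤
    ‖weakDeriv v‖ ^ 2 + κ ^ 2 * (‖toL2 v‖ ^ 2 * ‖weakDeriv v‖ ^ 2 - ‖toL2 v‖ ^ 4) := by
  rw [norm_riccati_sq, norm_removeMean_sq, integral_sqL2]
  grw [norm_sqL2_le]
  exact le_of_eq (by ring)

theorem toContinuous_smul_toH0 :
    toContinuous v • (toH0 w : L2T) = (toContinuous v * toContinuous w) • oneL2 := by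
  rw [mul_smul, toContinuous_smul_oneL2]
  rfl

theorem riccati_sub_riccati :
    riccati κ v - riccati κ w = -riccatiLin (κ • toH0 (v + w)) (v - w) := by
  have hmul : toContinuous (v - w) • (κ • toH0 (v + w) : L2T) = κ • (sqL2 v - sqL2 w) := by
    rw [smul_comm, toContinuous_smul_toH0, sqL2, sqL2, ← sub_smul, map_sub, map_add]
    congr 2
    ring
  rw [riccatiLin_apply, Submodule.coe_smul, hmul, map_smul, map_sub, map_sub, riccati, riccati]
  module

theorem locallyAntilipschitz_riccati : LocallyAntilipschitz (riccati κ) := by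
  intro y
  set R := ‖y‖ + 1
  have hbound (u : H1) (hu : u ∈ riccati κ ⁻¹' Metric.ball y 1) : ‖u‖ ≤ R :=
    (norm_le_norm_riccati κ u).trans (norm_lt_of_mem_ball (Set.mem_preimage.mp hu)).le
  refine ⟨Metric.ball y 1, Metric.ball_mem_nhds y one_pos, riccatiLinBound (|κ| * (R + R)),
    fun a ha b hb => ?_⟩
  rw [dist_eq_norm, dist_eq_norm, riccati_sub_riccati, norm_neg]
  refine norm_le_mul_norm_riccatiLin ?_ _
  rw [norm_smul, Real.norm_eq_abs, Submodule.coe_norm]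
  gcongr
  calc ‖toL2 (a + b)‖ ≤ ‖a + b‖ := norm_toL2_le _
    _ ≤ R + R := by grw [norm_add_le, hbound a ha, hbound b hb]

theorem analyticOnNhd_riccati : AnalyticOnNhd ℝ (riccati κ) Set.univ := by
  intro v _
  have hV : AnalyticAt ℝ toContinuous v := toContinuous.analyticAt v
  have hsq : AnalyticAt ℝ (fun v => removeMean (sqL2 v)) v :=
    ((removeMean ∘L smulOneL2).analyticAt _).comp (hV.mul hV)
  have hd : AnalyticAt ℝ derivEquiv v :=
    (derivEquiv.toContinuousLinearEquiv : H1 →L[ℝ] H0).analyticAt v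
  exact (hd.add (hsq.const_smul (c := κ))).neg

theorem hasFDerivAt_riccati :
    HasFDerivAt (riccati κ) (-riccatiLin ((2 * κ) • toH0 v)) v := by
  have hV : HasFDerivAt toContinuous toContinuous v := toContinuous.hasFDerivAt
  have hsq : HasFDerivAt (fun v => removeMean (sqL2 v)) _ v :=
    (removeMean ∘L smulOneL2).hasFDerivAt.comp v (hV.mul hV)
  have hd : HasFDerivAt derivEquiv (derivEquiv.toContinuousLinearEquiv : H1 →L[ℝ] H0) v :=
    (derivEquiv.toContinuousLinearEquiv : H1 →L[ℝ] H0).hasFDerivAt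
  refine (hd.add (hsq.const_smul κ)).neg.congr_fderiv ?_
  ext1 w
  have hmul : toContinuous w • ((2 * κ) • toH0 v : L2T) =
      κ • smulOneL2 (toContinuous v * toContinuous w + toContinuous v * toContinuous w) := by
    rw [smul_comm, toContinuous_smul_toH0, mul_comm (toContinuous w), map_add, mul_comm 2, mul_smul,
      two_smul]
    rfl
  simp only [neg_apply, riccatiLin_apply, Submodule.coe_smul, hmul, map_smul]
  rfl

/-- The derivative of the Riccati map at `v`, an isomorphism of `𝓗₁` onto `𝓗₀`. -/
def riccatiDeriv : H1 ≃L[ℝ] H0 :=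
  (riccatiLinEquiv ((2 * κ) • toH0 v)).trans (ContinuousLinearEquiv.neg ℝ)

theorem hasStrictFDerivAt_riccati :
    HasStrictFDerivAt (riccati κ) (riccatiDeriv κ v : H1 →L[ℝ] H0) v := by
  have h := (analyticOnNhd_riccati κ v trivial).hasStrictFDerivAt
  rw [(hasFDerivAt_riccati κ v).fderiv] at h
  exact h

theorem riccati_bijective : Function.Bijective (riccati κ) :=
  (locallyAntilipschitz_riccati κ).bijective_of_hasStrictFDerivAt_equiv
    (hasStrictFDerivAt_riccati κ)

/-- The Riccati map as a bijection of `𝓗₁` onto `𝓗₀`. -/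
def riccatiEquiv : H1 ≃ H0 := Equiv.ofBijective (riccati κ) (riccati_bijective κ)

theorem analyticOnNhd_riccatiEquiv_symm :
    AnalyticOnNhd ℝ (riccatiEquiv κ).symm Set.univ :=
  analyticOnNhd_symm_of_hasStrictFDerivAt_equiv (Φ := riccatiEquiv κ) (analyticOnNhd_riccati κ)
    (hasStrictFDerivAt_riccati κ)

end H1

/-! ### The Ricci eigenvalue and the Gaussian curvature -/

theorem integral_const_add_H0 (e : ℝ) (F : H0) : ∫ x, (e + (F : L2T) x) = e := by
  rw [integral_add (integrable_const e) ((Lp.memLp _).integrable (by norm_num)), integral_const,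
    mem_H0.mp F.2, probReal_univ, one_smul, add_zero]

theorem rotationalCurvature_of_hasDerivAt {r V : ℝ → ℝ} {x V' : ℝ} (hr : ∀ s, 0 < r s)
    (hr' : ∀ s, HasDerivAt r (r s * V s) s) (hV : HasDerivAt V V' x) (y : ℝ) :
    rotationalCurvature r x y = -V' - V x ^ 2 := by
  have hsqrt (s : ℝ) : √(1 * r s ^ 2) = r s := by rw [one_mul, Real.sqrt_sq (hr s).le]
  have hfirst : (fun s => deriv (fun s' => r s' ^ 2) s / √(1 * r s ^ 2))
      = fun s => 2 * (r s * V s) := by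
    funext s
    rw [hsqrt, ((hr' s).fun_pow 2).deriv]
    have := (hr s).ne'
    field_simp
    push_cast
    ring
  have hsecond : deriv (fun s => 2 * (r s * V s)) x = 2 * (r x * V x * V x + r x * V') :=
    (((hr' x).fun_mul hV).const_mul 2).deriv
  rw [rotationalCurvature, gaussianCurvature, hfirst, hsecond, hsqrt]
  simp only [deriv_const, zero_div, add_zero]
  have := (hr x).ne'
  field_simp
  ring

namespace H1

theorem coeFn_sqL2 (v : H1) : sqL2 v =ᵐ[volume] fun x => toL2 v x ^ 2 := by
  filter_upwards [coeFn_smul_oneL2 (toContinuous v * toContinuous v), coeFn_toL2 v] with x hsq hv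
  rw [sqL2, hsq, hv, ContinuousMap.mul_apply, sq]

theorem integral_toL2_sq (v : H1) : ∫ x, toL2 v x ^ 2 = ‖toL2 v‖ ^ 2 :=
  (integral_congr_ae (coeFn_sqL2 v)).symm.trans (integral_sqL2 v)

theorem coeFn_riccati (κ : ℝ) (v : H1) : (riccati κ v : L2T) =ᵐ[volume]
    fun x => -weakDeriv v x - κ * toL2 v x ^ 2 + κ * ‖toL2 v‖ ^ 2 := by
  have hcoe : (riccati κ v : L2T) =
      -(weakDeriv v + κ • sqL2 v) + (κ * ‖toL2 v‖ ^ 2) • oneL2 := by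
    rw [riccati, Submodule.coe_neg, Submodule.coe_add, Submodule.coe_smul, coe_derivEquiv,
      coe_removeMean, integral_sqL2]
    module
  rw [hcoe]
  filter_upwards [Lp.coeFn_add (-(weakDeriv v + κ • sqL2 v)) ((κ * ‖toL2 v‖ ^ 2) • oneL2),
    Lp.coeFn_neg (weakDeriv v + κ • sqL2 v), Lp.coeFn_add (weakDeriv v) (κ • sqL2 v),
    Lp.coeFn_smul κ (sqL2 v), Lp.coeFn_smul (κ * ‖toL2 v‖ ^ 2) oneL2, coeFn_sqL2 v,
    Lp.coeFn_const (p := 2) (μ := (volume : Measure UnitAddCircle)) (1 : ℝ)]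
    with x hadd hneg hadd' hsmul hsmul' hsq hone
  simp only [hadd, hneg, hadd', hsmul, hsmul', hsq, hone, Pi.add_apply, Pi.neg_apply,
    Pi.smul_apply, Function.const_apply, smul_eq_mul]
  ring

/-- Multiplication by `2` on `𝓗₁`, which turns `q` into `v = 2q`. -/
def doubling : H1 ≃L[ℝ] H1 := .smulLeft (Units.mk0 (2 : ℝ) two_ne_zero)

/-- The map `q ↦ ℰ₁` as a bijection of `𝓗₁` onto `𝓗₀`. -/
def ricciEquiv (m : ℕ) : H1 ≃ H0 := doubling.toEquiv.trans (riccatiEquiv (1 / m))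

theorem ricciEquiv_apply (m : ℕ) (q : H1) : ricciEquiv m q = riccati (1 / m) ((2 : ℝ) • q) := rfl

theorem analyticOnNhd_ricciEquiv (m : ℕ) : AnalyticOnNhd ℝ (ricciEquiv m) Set.univ :=
  fun q _ => (analyticOnNhd_riccati (1 / m) (doubling q) trivial).comp
    ((doubling : H1 →L[ℝ] H1).analyticAt q)

theorem analyticOnNhd_ricciEquiv_symm (m : ℕ) : AnalyticOnNhd ℝ (ricciEquiv m).symm Set.univ :=
  fun F _ => ((doubling.symm : H1 →L[ℝ] H1).analyticAt _).comp
    (analyticOnNhd_riccatiEquiv_symm (1 / m) F trivial)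

theorem coeFn_ricciEquiv (m : ℕ) (q : H1) :
    (ricciEquiv m q : L2T) =ᵐ[volume] ricciNonconst m q := by
  filter_upwards [coeFn_riccati (1 / m) ((2 : ℝ) • q)] with x hx
  rw [ricciEquiv_apply, hx, ricciNonconst, integral_toL2_sq]
  ring

theorem norm_ricciEquiv_sq_le (m : ℕ) (q : H1) : ‖ricciEquiv m q‖ ^ 2 ≤
    ‖weakDeriv ((2 : ℝ) • q)‖ ^ 2
      + ‖toL2 ((2 : ℝ) • q)‖ ^ 2 * ‖weakDeriv ((2 : ℝ) • q)‖ ^ 2 / (m : ℝ) ^ 2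
      - ‖toL2 ((2 : ℝ) • q)‖ ^ 4 / (m : ℝ) ^ 2 := by
  rw [ricciEquiv_apply]
  exact (norm_riccati_sq_le (1 / m) _).trans_eq (by ring)

theorem ricciEigenvalue_eq_add_ricciNonconst (m : ℕ) (q : H1) (x : UnitAddCircle) :
    ricciEigenvalue m q x = -(1 / m) * ‖toL2 ((2 : ℝ) • q)‖ ^ 2 + ricciNonconst m q x := by
  rw [ricciEigenvalue, ricciNonconst, integral_toL2_sq]
  ring

theorem ricciConst_eq (m : ℕ) (q : H1) :
    ricciConst m q = -(1 / m) * ‖toL2 ((2 : ℝ) • q)‖ ^ 2 := by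
  rw [← integral_const_add_H0 (-(1 / m) * ‖toL2 ((2 : ℝ) • q)‖ ^ 2) (ricciEquiv m q), ricciConst]
  refine integral_congr_ae ?_
  filter_upwards [coeFn_ricciEquiv m q] with x hx
  rw [hx, ricciEigenvalue_eq_add_ricciNonconst]

theorem ricciEigenvalue_eq (m : ℕ) (q : H1) (x : UnitAddCircle) :
    ricciEigenvalue m q x = ricciConst m q + ricciNonconst m q x := by
  rw [ricciConst_eq, ricciEigenvalue_eq_add_ricciNonconst]

theorem ae_ricciEigenvalue_eq_iff (m : ℕ) (q : H1) (e : ℝ) (F : H0) :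
    (∀ᵐ x : UnitAddCircle, ricciEigenvalue m q x = e + (F : L2T) x) ↔
      ricciEquiv m q = F ∧ ricciConst m q = e := by
  constructor
  · intro h
    have he : ricciConst m q = e := (integral_congr_ae h).trans (integral_const_add_H0 e F)
    refine ⟨Subtype.ext (Lp.ext ?_), he⟩
    filter_upwards [h, coeFn_ricciEquiv m q] with x hE hΦ
    rw [ricciEigenvalue_eq, he] at hE
    exact hΦ.trans (add_left_cancel hE)
  · rintro ⟨rfl, rfl⟩
    filter_upwards [coeFn_ricciEquiv m q] with x hx
    rw [hx, ricciEigenvalue_eq]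

theorem existsUnique_ricciEigenvalue_eq (m : ℕ) (F : H0) : ∃! p : H1 × ℝ,
    ∀ᵐ x : UnitAddCircle, ricciEigenvalue m p.1 x = p.2 + (F : L2T) x := by
  simp only [ae_ricciEigenvalue_eq_iff]
  refine ⟨((ricciEquiv m).symm F, ricciConst m ((ricciEquiv m).symm F)),
    ⟨(ricciEquiv m).apply_symm_apply F, rfl⟩, ?_⟩
  rintro ⟨q, e⟩ ⟨hF, he⟩
  dsimp only at hF he
  rw [← hF, ← he, (ricciEquiv m).symm_apply_apply]

theorem profile_pos (m : ℕ) {r₀ : ℝ} (hr₀ : 0 < r₀) (q : H1) (x : ℝ) : 0 < profile m r₀ q x :=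
  mul_pos hr₀ (Real.exp_pos _)

theorem hasDerivAt_profile (m : ℕ) (r₀ : ℝ) (q : H1) (x : ℝ) : HasDerivAt (profile m r₀ q)
    (profile m r₀ q x * (toContinuous ((2 : ℝ) • q) x / m)) x := by
  have hcont : Continuous fun t : ℝ => toContinuous q t :=
    (toContinuous q).continuous.comp (AddCircle.continuous_mk' 1)
  have hprofile : profile m r₀ q = fun x : ℝ =>
      r₀ * Real.exp ((2 / m) * ∫ t in (0 : ℝ)..x, toContinuous q t) := by
    funext x
    rw [profile]
    congr 3
    refine intervalIntegral.integral_congr_ae ?_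
    filter_upwards [ae_coe_iff.mpr (coeFn_toL2 q)] with t ht _ using ht
  rw [hprofile]
  have hint := (hcont.integral_hasStrictDerivAt 0 x).hasDerivAt
  refine ((hint.const_mul (2 / (m : ℝ))).exp.const_mul r₀).congr_deriv ?_
  rw [map_smul, ContinuousMap.smul_apply, smul_eq_mul]
  ring

theorem ae_rotationalCurvature_profile {r₀ : ℝ} (hr₀ : 0 < r₀) (q : H1) :
    ∀ᵐ x : ℝ, ∀ y : ℝ, rotationalCurvature (profile 1 r₀ q) x y = ricciEigenvalue 1 q x := by
  set v := (2 : ℝ) • q with hv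
  have hderiv (s : ℝ) :
      HasDerivAt (profile 1 r₀ q) (profile 1 r₀ q s * toContinuous v s) s := by
    simpa only [Nat.cast_one, div_one] using hasDerivAt_profile 1 r₀ q s
  filter_upwards [(isPrimitive_toContinuous v).ae_hasDerivAt, ae_coe_iff.mpr (coeFn_toL2 v)]
    with x hV htoL2 y
  rw [rotationalCurvature_of_hasDerivAt (profile_pos 1 hr₀ q) hderiv hV, ricciEigenvalue, ← hv,
    htoL2, Nat.cast_one, div_one, lift]

theorem existsUnique_rotationalCurvature_eq {r₀ : ℝ} (hr₀ : 0 < r₀) (F : H0) :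
    ∃! p : (ℝ → ℝ) × ℝ, (∃ q : H1, p.1 = profile 1 r₀ q) ∧
      ∀ᵐ x : ℝ, ∀ y : ℝ, rotationalCurvature p.1 x y = p.2 + lift (F : L2T) x := by
  have hiff (q : H1) (e : ℝ) : (∀ᵐ x : ℝ, ∀ y : ℝ,
      rotationalCurvature (profile 1 r₀ q) x y = e + lift (F : L2T) x) ↔
        ∀ᵐ x : UnitAddCircle, ricciEigenvalue 1 q x = e + (F : L2T) x := by
    rw [← ae_coe_iff]
    refine Filter.eventually_congr ?_
    filter_upwards [ae_rotationalCurvature_profile hr₀ q] with x hx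
    simp only [hx, forall_const, lift]
  obtain ⟨⟨q, e⟩, hqe, hunique⟩ := existsUnique_ricciEigenvalue_eq 1 F
  refine ⟨(profile 1 r₀ q, e), ⟨⟨q, rfl⟩, (hiff q e).mpr hqe⟩, ?_⟩
  rintro ⟨_, e'⟩ ⟨⟨q', rfl⟩, h⟩
  obtain ⟨rfl, rfl⟩ := Prod.mk.inj (hunique (q', e') ((hiff q' e').mp h))
  rfl

end H1

end PerturbedTorus

end

theorem corollary2p5 (m : ℕ) (hm : 1 ≤ m) :
    ∃ Φ : PerturbedTorus.H1 ≃ PerturbedTorus.H0,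
      -- `Φ` is the map `q ↦ ℰ₁`
      (∀ q : PerturbedTorus.H1,
        ((Φ q : PerturbedTorus.L2T) : UnitAddCircle → ℝ) =ᵐ[volume]
          PerturbedTorus.ricciNonconst m q) ∧
      -- it is a real analytic isomorphism
      AnalyticOnNhd ℝ (Φ : PerturbedTorus.H1 → PerturbedTorus.H0) Set.univ ∧
      AnalyticOnNhd ℝ (Φ.symm : PerturbedTorus.H0 → PerturbedTorus.H1) Set.univ ∧
      -- two-sided estimates, with `v = 2q` and `L²`-norms throughout
      (∀ q : PerturbedTorus.H1, ∀ v : PerturbedTorus.H1, v = (2 : ℝ) • q →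
        ‖PerturbedTorus.H1.weakDeriv v‖ ^ 2 ≤ ‖Φ q‖ ^ 2 ∧
        ‖Φ q‖ ^ 2 ≤ ‖PerturbedTorus.H1.weakDeriv v‖ ^ 2
          + ‖PerturbedTorus.H1.toL2 v‖ ^ 2 * ‖PerturbedTorus.H1.weakDeriv v‖ ^ 2 / (m : ℝ) ^ 2
          - ‖PerturbedTorus.H1.toL2 v‖ ^ 4 / (m : ℝ) ^ 2) ∧
      -- the decomposition `ℰ = ℰ₀ + ℰ₁` with `ℰ₀ = -(1/m) ∫ v² ≤ 0`
      (∀ q : PerturbedTorus.H1,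
        PerturbedTorus.ricciConst m q
          = -(1 / (m : ℝ)) * ‖PerturbedTorus.H1.toL2 ((2 : ℝ) • q)‖ ^ 2 ∧
        ∀ x, PerturbedTorus.ricciEigenvalue m q x
          = PerturbedTorus.ricciConst m q + PerturbedTorus.ricciNonconst m q x) ∧
      -- `ℰ₀` is determined by `ℰ₁`
      (∃ κ : PerturbedTorus.H0 → ℝ,
        ∀ q : PerturbedTorus.H1, PerturbedTorus.ricciConst m q = κ (Φ q)) ∧
      (∀ F : PerturbedTorus.H0, ∃! p : PerturbedTorus.H1 × ℝ,
        ∀ᵐ x : UnitAddCircle, PerturbedTorus.ricciEigenvalue m p.1 x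
          = p.2 + (F : PerturbedTorus.L2T) x) ∧
      -- for `m = 1`: prescribed non-constant part of the Gaussian curvature
      (m = 1 → ∀ r₀ : ℝ, 0 < r₀ → ∀ F : PerturbedTorus.H0, ∃! p : (ℝ → ℝ) × ℝ,
        (∃ q : PerturbedTorus.H1, p.1 = PerturbedTorus.profile m r₀ q) ∧
        ∀ᵐ x : ℝ, ∀ y : ℝ, PerturbedTorus.rotationalCurvature p.1 x y
          = p.2 + PerturbedTorus.lift (F : PerturbedTorus.L2T) x) := by
  refine ⟨PerturbedTorus.H1.ricciEquiv m, PerturbedTorus.H1.coeFn_ricciEquiv m,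
    PerturbedTorus.H1.analyticOnNhd_ricciEquiv m,
    PerturbedTorus.H1.analyticOnNhd_ricciEquiv_symm m, ?_,
    fun q => ⟨PerturbedTorus.H1.ricciConst_eq m q, PerturbedTorus.H1.ricciEigenvalue_eq m q⟩,
    ⟨fun F => PerturbedTorus.ricciConst m ((PerturbedTorus.H1.ricciEquiv m).symm F), fun q => ?_⟩,
    PerturbedTorus.H1.existsUnique_ricciEigenvalue_eq m, ?_⟩
  · rintro q v rfl
    exact ⟨PerturbedTorus.H1.norm_weakDeriv_sq_le_norm_riccati_sq (1 / m) _,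
      PerturbedTorus.H1.norm_ricciEquiv_sq_le m q⟩
  · exact congrArg _ ((PerturbedTorus.H1.ricciEquiv m).symm_apply_apply q).symm
  · rintro rfl r₀ hr₀
    exact PerturbedTorus.H1.existsUnique_rotationalCurvature_eq hr₀
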